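/- Let $d\ge 1$ and $\varepsilon\in(0,1/2)$. Let $\mu_0,\mu_1,\dots,\mu_d$ be probability measures on $\mathbb{R}^d$, each absolutely continuous with respect to Lebesgue measure. A halfspace is a set $H=\{x\in\mathbb{R}^d : \langle v,x\rangle\le c\}$ with $v\in\mathbb{R}^d\setminus\{0\}$ and $c\in\mathbb{R}$. Assume that the measures are $\varepsilon$-not-permuted, that is, for every halfspace $H$ such that $\mu_i(H)<\varepsilon$ for all $i=0,\dots,d$, there are indices $i<j$ with $\mu_i(H)\ge\mu_j(H)$. Then there exists a halfspace $H$ such that \[ \mu_0(H)=\mu_1(H)=\dots=\mu_d(H)\in[\varepsilon,1/2]. \] -/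

import Mathlib

open MeasureTheory

/-- A (non-degenerate) closed halfspace of `ℝ^d`: the boundary is a genuine hyperplane, so neither
`∅` nor the whole space is a halfspace. For absolutely continuous measures the boundary hyperplane
is null, so open and closed halfspaces are interchangeable. -/
def IsHalfspace {d : ℕ} (H : Set (EuclideanSpace ℝ (Fin d))) : Prop :=
  ∃ (v : EuclideanSpace ℝ (Fin d)) (c : ℝ), v ≠ 0 ∧ H = {x | inner ℝ v x ≤ c}

/-- The family `μ 0, …, μ d` is `ε`-not-permuted: no halfspace `H` has `μ i H < ε` for all `i` and
`μ 0 H < μ 1 H < ⋯ < μ d H`. -/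
def NotPermuted {d : ℕ} (ε : ℝ) (μ : Fin (d + 1) → Measure (EuclideanSpace ℝ (Fin d))) : Prop :=
  ∀ H : Set (EuclideanSpace ℝ (Fin d)), IsHalfspace H →
    (∀ i, (μ i).real H < ε) → ∃ i j, i < j ∧ (μ j).real H ≤ (μ i).real H

/-! Points of the unit `d`-sphere parametrise halfspaces, antipodes being complements up to a null
set. With `m i` the masses and `φ` an odd function positive only if all `m i < ε`, `borsuk_ulam`
gives a zero of the odd map with entries `m (i+1) - m i - φ`. There `φ > 0` would make the masses
small and strictly increasing, against `NotPermuted`; `φ < 0` does so at the antipode. Hence `φ =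
0`, all masses agree, and `φ = 0` also keeps the common value in `[ε, 1 - ε]`.

Borsuk–Ulam is proved algebraically. Approximation by polynomials reduces it to common zeros of `n`
real forms of odd degree `D` in `n + 1` variables. After dehomogenising, `X i ^ D + u * f i`
generates an ideal of codimension `D ^ n` for all but countably many `u`. This is odd, so a real
zero exists; letting `u` grow gives approximate zeros of the forms, and compactness an exact one. -/

/-! ### Real zeros of ideals of odd codimension -/

open Polynomial Filter in
theorem exists_isRoot_of_monic_of_odd_natDegree {p : ℝ[X]} (hp : p.Monic) (hd : Odd p.natDegree) :
    ∃ x, p.IsRoot x := by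
  have hdeg : 0 < p.degree := natDegree_pos_iff_degree_pos.1 hd.pos
  have h1 : Tendsto (fun x => p.eval x) atTop atTop :=
    p.tendsto_atTop_of_leadingCoeff_nonneg hdeg (by rw [hp.leadingCoeff]; norm_num)
  have h2 : Tendsto (fun x => (-p.comp (-X)).eval x) atTop atTop := by
    refine tendsto_atTop_of_leadingCoeff_nonneg _ ?_ ?_
    · rw [degree_neg, ← natDegree_pos_iff_degree_pos, natDegree_comp]
      simpa using hd.pos
    · rw [leadingCoeff_neg, leadingCoeff_comp (by simp), hp.leadingCoeff]
      simp [hd.neg_one_pow]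
  obtain ⟨a, ha⟩ := (h1.eventually_ge_atTop 0).exists
  obtain ⟨b, hb⟩ := (h2.eventually_ge_atTop 0).exists
  simp only [eval_neg, eval_comp, eval_X, Left.nonneg_neg_iff] at hb
  exact mem_range_of_exists_le_of_exists_ge p.continuous ⟨-b, hb⟩ ⟨a, ha⟩

/-- A module of odd real dimension over a commutative real algebra contains a common eigenvector. -/
theorem exists_common_eigenvector_of_odd_finrank {A : Type*} [CommRing A] [Algebra ℝ A] (N : ℕ) :
    ∀ (M : Type) [AddCommGroup M] [Module ℝ M] [Module A M] [IsScalarTower ℝ A M],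
      Module.finrank ℝ M = N → Odd N → ∃ m : M, m ≠ 0 ∧ ∀ a : A, ∃ c : ℝ, a • m = c • m := by
  induction N using Nat.strong_induction_on with
  | _ N ih =>
    intro M _ _ _ _ hM hN
    have hpos : 0 < Module.finrank ℝ M := hM ▸ hN.pos
    have : FiniteDimensional ℝ M := Module.finite_of_finrank_pos hpos
    have : Nontrivial M := Module.nontrivial_of_finrank_pos hpos
    by_cases hs : ∀ a : A, ∃ c : ℝ, ∀ m : M, a • m = c • m
    · obtain ⟨m, hm⟩ := exists_ne (0 : M)
      exact ⟨m, hm, fun a => (hs a).imp fun c hc => hc m⟩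
    push Not at hs
    obtain ⟨a, ha⟩ := hs
    obtain ⟨c, hc⟩ : ∃ c : ℝ, (Algebra.lsmul ℝ ℝ M a).HasEigenvalue c := by
      obtain ⟨c, hc⟩ := exists_isRoot_of_monic_of_odd_natDegree
        (LinearMap.charpoly_monic (Algebra.lsmul ℝ ℝ M a))
        (by rwa [LinearMap.charpoly_natDegree, hM])
      exact ⟨c, Module.End.hasEigenvalue_iff_isRoot_charpoly _ _ |>.2 hc⟩
    -- Kernel and image of `b` are `A`-submodules as `A` is commutative, and proper since `c` is an
    -- eigenvalue but `a` is not the scalar `c`. Their dimensions sum to an odd number, so induction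
    -- applies to one of them.
    set b : A := a - algebraMap ℝ A c with hb
    have hbm : ∀ m : M, b • m = a • m - c • m := fun m => by
      rw [hb, sub_smul, algebraMap_smul]
    let φ : M →ₗ[A] M := LinearMap.lsmul A M b
    have hrank := LinearMap.finrank_range_add_finrank_ker (φ.restrictScalars ℝ)
    obtain ⟨v, hv⟩ := hc.exists_hasEigenvector
    have hker0 : 0 < Module.finrank ℝ (LinearMap.ker (φ.restrictScalars ℝ)) := by
      rw [Module.finrank_pos_iff_exists_ne_zero]
      refine ⟨⟨v, ?_⟩, fun h => hv.2 (congrArg Subtype.val h)⟩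
      have := hv.apply_eq_smul
      simp only [Algebra.lsmul_coe] at this
      simp [φ, hbm, this]
    have hrange0 : 0 < Module.finrank ℝ (LinearMap.range (φ.restrictScalars ℝ)) := by
      rw [Module.finrank_pos_iff_exists_ne_zero]
      obtain ⟨m, hm⟩ := ha c
      refine ⟨⟨b • m, m, rfl⟩, fun h => hm ?_⟩
      have := congrArg Subtype.val h
      simp only [hbm] at this
      exact sub_eq_zero.1 this
    rw [hM] at hrank
    have step (P : Submodule A M) (hlt : Module.finrank ℝ P < N) (hP : Odd (Module.finrank ℝ P)) :
        ∃ m : M, m ≠ 0 ∧ ∀ a : A, ∃ c : ℝ, a • m = c • m := by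
      have : IsScalarTower ℝ A P := ⟨fun x y z => Subtype.ext (smul_assoc x y (z : M))⟩
      obtain ⟨m, hm, hm'⟩ := ih _ hlt P rfl hP
      exact ⟨m, fun h => hm (Subtype.ext h), fun a => (hm' a).imp fun c hc =>
        congrArg Subtype.val hc⟩
    have er : Module.finrank ℝ (LinearMap.range (φ.restrictScalars ℝ)) =
      Module.finrank ℝ (LinearMap.range φ) := rfl
    have ek : Module.finrank ℝ (LinearMap.ker (φ.restrictScalars ℝ)) =
      Module.finrank ℝ (LinearMap.ker φ) := rfl
    rw [er] at hrank hrange0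
    rw [ek] at hrank hker0
    have hcase : Odd (Module.finrank ℝ (LinearMap.range (φ.restrictScalars ℝ))) ∨
        Odd (Module.finrank ℝ (LinearMap.ker (φ.restrictScalars ℝ))) := by
      by_contra! h
      simp only [Nat.not_odd_iff_even] at h
      exact Nat.not_odd_iff_even.2 (hrank ▸ h.1.add h.2) hN
    rcases hcase with h | h
    · exact step (LinearMap.range φ) (by omega) h
    · exact step (LinearMap.ker φ) (by omega) h

open MvPolynomial in
/-- An ideal of odd real codimension in a real polynomial ring has a real zero. -/
theorem exists_zero_of_odd_finrank_quotient {σ : Type} (I : Ideal (MvPolynomial σ ℝ))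
    (h : Odd (Module.finrank ℝ (MvPolynomial σ ℝ ⧸ I))) :
    ∃ x : σ → ℝ, ∀ p ∈ I, eval x p = 0 := by
  obtain ⟨m, hm, hm'⟩ := exists_common_eigenvector_of_odd_finrank (A := MvPolynomial σ ℝ) _
    (MvPolynomial σ ℝ ⧸ I) rfl h
  choose c hc using fun i => hm' (X i)
  refine ⟨c, fun p hp => ?_⟩
  have key : ∀ q : MvPolynomial σ ℝ, q • m = eval c q • m := by
    intro q
    induction q using MvPolynomial.induction_on with
    | C a => rw [eval_C, ← algebraMap_eq, algebraMap_smul]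
    | add p q hp hq => rw [add_smul, hp, hq, map_add, add_smul]
    | mul_X p i hp =>
      rw [mul_smul, hc, smul_comm, hp, map_mul, eval_X, smul_smul, mul_comm]
  have h0 : p • m = 0 := by
    obtain ⟨q, rfl⟩ := Ideal.Quotient.mk_surjective m
    rw [← Ideal.Quotient.mk_eq_mk, ← Submodule.Quotient.mk_smul, Submodule.Quotient.mk_eq_zero]
    exact I.mul_mem_right _ hp
  rw [key, smul_eq_zero] at h0
  exact h0.resolve_right hm

/-! ### Codimension of perturbed power ideals -/

namespace MvPolynomial

/-- The linear map sending the monomial `∏ i, X i ^ (D * b i + a i)` with all `a i < D` to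
`∏ i, X i ^ a i * F i ^ b i`. -/
noncomputable def substPow {σ R : Type*} [Fintype σ] [CommRing R] (D : ℕ)
    (F : σ → MvPolynomial σ R) : MvPolynomial σ R →ₗ[R] MvPolynomial σ R :=
  (basisMonomials σ R).constr R fun e => ∏ i, (X i ^ (e i % D) * F i ^ (e i / D))

section

variable {σ R : Type*} [Fintype σ] [CommRing R] {D : ℕ} {F : σ → MvPolynomial σ R}

theorem substPow_monomial (e : σ →₀ ℕ) (c : R) :
    substPow D F (monomial e c) = c • ∏ i, (X i ^ (e i % D) * F i ^ (e i / D)) := by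
  have h : monomial e c = c • basisMonomials σ R e := by
    rw [coe_basisMonomials, smul_monomial, smul_eq_mul, mul_one]
  rw [h, map_smul, substPow, Module.Basis.constr_basis]

theorem substPow_eq_sum (p : MvPolynomial σ R) :
    substPow D F p = ∑ e ∈ p.support, coeff e p • ∏ i, (X i ^ (e i % D) * F i ^ (e i / D)) := by
  conv_lhs => rw [← support_sum_monomial_coeff p, map_sum]
  exact Finset.sum_congr rfl fun e _ => substPow_monomial e _

theorem totalDegree_prod_pow_mod_mul_pow_div_le [Nontrivial R] (hF : ∀ i, (F i).totalDegree ≤ D)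
    (e : σ →₀ ℕ) :
    (∏ i, (X i ^ (e i % D) * F i ^ (e i / D))).totalDegree ≤ e.degree := by
  rw [Finsupp.degree_eq_sum]
  refine (totalDegree_finsetProd _ _).trans (Finset.sum_le_sum fun i _ => ?_)
  refine (totalDegree_mul _ _).trans ?_
  rw [totalDegree_X_pow]
  calc e i % D + (F i ^ (e i / D)).totalDegree ≤ e i % D + e i / D * D := by
        gcongr
        exact (totalDegree_pow _ _).trans (Nat.mul_le_mul_left _ (hF i))
    _ = e i := by rw [mul_comm]; exact Nat.mod_add_div _ _

theorem degree_le_totalDegree {p : MvPolynomial σ R} {e : σ →₀ ℕ} (he : e ∈ p.support) :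
    e.degree ≤ p.totalDegree := by
  have := le_totalDegree he
  rwa [Finsupp.sum_fintype _ _ (fun _ => rfl), ← Finsupp.degree_eq_sum] at this

theorem totalDegree_substPow_le [Nontrivial R] (hF : ∀ i, (F i).totalDegree ≤ D)
    (p : MvPolynomial σ R) : (substPow D F p).totalDegree ≤ p.totalDegree := by
  rw [substPow_eq_sum]
  refine (totalDegree_finsetSum _ _).trans (Finset.sup_le fun e he => ?_)
  exact (totalDegree_smul_le _ _).trans
    ((totalDegree_prod_pow_mod_mul_pow_div_le hF e).trans (degree_le_totalDegree he))

/-- Raising an exponent by `D` raises its quotient by one and keeps its residue. Thus a bijective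
`substPow` carries the ideal of the `X i ^ D` onto that of the `F i`. -/
theorem mul_substPow (hD : 0 < D) (i : σ) (p : MvPolynomial σ R) :
    F i * substPow D F p = substPow D F (X i ^ D * p) := by
  classical
  induction p using MvPolynomial.induction_on' with
  | add p q hp hq => rw [map_add, mul_add, hp, hq, mul_add, map_add]
  | monomial e c =>
    rw [X_pow_eq_monomial, monomial_mul, one_mul, substPow_monomial, substPow_monomial,
      mul_smul_comm]
    congr 1
    rw [← Finset.mul_prod_erase _ _ (Finset.mem_univ i),
      ← Finset.mul_prod_erase _ _ (Finset.mem_univ i), ← mul_assoc]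
    congr 1
    · simp only [Finsupp.add_apply, Finsupp.single_eq_same, Nat.add_mod_left,
        Nat.add_div_left _ hD, pow_succ]
      ring
    · refine Finset.prod_congr rfl fun j hj => ?_
      have : (Finsupp.single i D) j = 0 := Finsupp.single_eq_of_ne (Finset.ne_of_mem_erase hj)
      simp [this]

end

section

variable {σ : Type*} [Fintype σ] {D : ℕ}

/-- If the substitution matrix in degrees at most `N` is invertible for every `N`, then
`substPow` is bijective. -/
theorem bijective_substPow_of_det_ne_zero [DecidableEq σ] {K : Type*} [Field K]
    {F : σ → MvPolynomial σ K}
    (hF : ∀ i, (F i).totalDegree ≤ D) [∀ N, Fintype {e : σ →₀ ℕ // e.degree ≤ N}]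
    (h : ∀ N, (Matrix.of fun e' e : {e : σ →₀ ℕ // e.degree ≤ N} =>
      coeff e'.1 (∏ i, (X i ^ (e.1 i % D) * F i ^ (e.1 i / D)))).det ≠ 0) :
    Function.Bijective (substPow D F) := by
  have hinj : Function.Injective (substPow D F) := by
    rw [← LinearMap.ker_eq_bot, LinearMap.ker_eq_bot']
    intro p hp
    have hz := Matrix.eq_zero_of_mulVec_eq_zero (h p.totalDegree)
      (v := fun e => coeff e.1 p) <| by
      ext e'
      have : coeff e'.1 (substPow D F p) = 0 := by rw [hp, coeff_zero]
      rw [substPow_eq_sum, coeff_sum] at this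
      rw [Pi.zero_apply, ← this, Matrix.mulVec, dotProduct]
      simp only [Matrix.of_apply, coeff_smul, smul_eq_mul]
      rw [← Finset.sum_subtype_of_mem (p := fun e => e.degree ≤ p.totalDegree)
        (fun e => coeff e p * coeff e'.1 (∏ i, (X i ^ (e i % D) * F i ^ (e i / D))))
        (fun e he => degree_le_totalDegree he)]
      symm
      refine (Finset.sum_subset (Finset.subset_univ _) fun e _ he => ?_).trans
        (Finset.sum_congr rfl fun e _ => mul_comm _ _)
      simp only [Finset.mem_subtype, notMem_support_iff] at he
      simp [he]
    ext e
    by_cases he : e.degree ≤ p.totalDegree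
    · exact congrFun hz ⟨e, he⟩
    · rw [coeff_zero, ← notMem_support_iff]
      exact fun h => he (degree_le_totalDegree h)
  refine ⟨hinj, fun q => ?_⟩
  -- Surjectivity follows from injectivity on the finite-dimensional space of bounded degree, which
  -- the map preserves.
  have hmaps : ∀ p ∈ restrictTotalDegree σ K q.totalDegree,
      substPow D F p ∈ restrictTotalDegree σ K q.totalDegree := fun p hp => by
    rw [mem_restrictTotalDegree] at hp ⊢
    exact (totalDegree_substPow_le hF p).trans hp
  have hsurj := (LinearMap.injective_iff_surjective
    (f := (substPow D F).restrict hmaps)).1 fun a b hab =>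
      Subtype.ext (hinj (congrArg Subtype.val hab))
  obtain ⟨p, hp⟩ := hsurj ⟨q, (mem_restrictTotalDegree ..).2 le_rfl⟩
  exact ⟨p, congrArg Subtype.val hp⟩

/-- Each determinant is a polynomial in `u` with value 1 at `u = 0`, so it has finitely many roots;
`Z` collects them over all degrees. -/
theorem exists_countable_bijective_substPow {f : σ → MvPolynomial σ ℝ}
    (hf : ∀ i, (f i).totalDegree ≤ D) :
    ∃ Z : Set ℝ, Z.Countable ∧ ∀ u ∉ Z,
      Function.Bijective (substPow D fun i => X i ^ D + C u * f i) := by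
  classical
  have (N : ℕ) : Fintype {e : σ →₀ ℕ // e.degree ≤ N} :=
    (Finsupp.finite_of_degree_le N).fintype
  let G : σ → MvPolynomial σ (Polynomial ℝ) := fun i =>
    X i ^ D + C Polynomial.X * map Polynomial.C (f i)
  let P (N : ℕ) : Polynomial ℝ := (Matrix.of fun e' e : {e : σ →₀ ℕ // e.degree ≤ N} =>
      coeff e'.1 (∏ i, (X i ^ (e.1 i % D) * G i ^ (e.1 i / D)))).det
  have hG (u : ℝ) (i : σ) : map (Polynomial.evalRingHom u) (G i) = X i ^ D + C u * f i := by
    have : (Polynomial.evalRingHom u).comp Polynomial.C = RingHom.id ℝ := by ext; simp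
    simp [G, map_map, this, map_id]
  have hP (N : ℕ) (u : ℝ) : (P N).eval u = (Matrix.of fun e' e : {e : σ →₀ ℕ // e.degree ≤ N} =>
      coeff e'.1 (∏ i, (X i ^ (e.1 i % D) * (X i ^ D + C u * f i) ^ (e.1 i / D)))).det := by
    rw [← Polynomial.coe_evalRingHom, RingHom.map_det]
    congr 1
    ext e' e
    simp only [RingHom.mapMatrix_apply, Matrix.map_apply, Matrix.of_apply, ← coeff_map, map_prod,
      map_mul, map_pow, map_X, hG]
  have hP0 (N : ℕ) : P N ≠ 0 := by
    intro h0
    have h1 := hP N 0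
    rw [h0, Polynomial.eval_zero, show (Matrix.of fun e' e : {e : σ →₀ ℕ // e.degree ≤ N} =>
      coeff e'.1 (∏ i, (X i ^ (e.1 i % D) * (X i ^ D + C 0 * f i) ^ (e.1 i / D)))) = 1 from ?_,
      Matrix.det_one] at h1
    · exact zero_ne_one h1
    ext e' e
    have : ∏ i, (X i ^ (e.1 i % D) * (X i ^ D + C 0 * f i) ^ (e.1 i / D)) =
        monomial e.1 (1 : ℝ) := by
      rw [monomial_eq, map_one, one_mul, Finsupp.prod_fintype _ _ (fun _ => pow_zero _)]
      refine Finset.prod_congr rfl fun i _ => ?_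
      rw [map_zero, zero_mul, add_zero, ← pow_mul, ← pow_add, Nat.mod_add_div]
    rw [Matrix.of_apply, this, coeff_monomial, Matrix.one_apply]
    simp [Subtype.ext_iff, eq_comm]
  refine ⟨⋃ N, {u | (P N).IsRoot u}, Set.countable_iUnion fun N =>
    (Polynomial.finite_setOfPred_isRoot (hP0 N)).countable, fun u hu => ?_⟩
  refine bijective_substPow_of_det_ne_zero (fun i => ?_) fun N => ?_
  · refine (totalDegree_add _ _).trans (max_le (totalDegree_X_pow _ _).le ?_)
    rw [← smul_eq_C_mul]
    exact (totalDegree_smul_le _ _).trans (hf i)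
  · rw [← hP]
    exact fun h => hu (Set.mem_iUnion.2 ⟨N, h⟩)

end

/-- If `substPow D F` is bijective then `F` generates an ideal of codimension `D ^ card σ`. -/
theorem finrank_quotient_span_of_bijective_substPow {σ : Type*} [Fintype σ] {D : ℕ} (hD : 0 < D)
    {F : σ → MvPolynomial σ ℝ} (hT : Function.Bijective (substPow D F)) :
    Module.finrank ℝ (MvPolynomial σ ℝ ⧸ Ideal.span (Set.range F)) = D ^ Fintype.card σ := by
  classical
  let ι : (σ → Fin D) → σ →₀ ℕ := fun a => Finsupp.equivFunOnFinite.symm fun i => (a i : ℕ)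
  have hι : Function.Injective ι := fun a b h => by
    ext i
    exact DFunLike.congr_fun h i
  let π : MvPolynomial σ ℝ →ₗ[ℝ] (σ → Fin D) → ℝ := LinearMap.pi fun a => lcoeff ℝ (ι a)
  have hπ : Function.Surjective π := fun w => by
    refine ⟨∑ a, monomial (ι a) (w a), ?_⟩
    ext a
    simp [π, coeff_monomial, hι.eq_iff]
  let T := LinearEquiv.ofBijective (substPow D F) hT
  have hI : (Ideal.span (Set.range F)).restrictScalars ℝ =
      LinearMap.ker (π ∘ₗ T.symm.toLinearMap) := by
    apply le_antisymm
    · intro p hp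
      rw [Submodule.restrictScalars_mem, Ideal.mem_span_range_iff_exists_fun] at hp
      obtain ⟨c, rfl⟩ := hp
      refine Submodule.sum_mem _ fun i _ => ?_
      obtain ⟨g, hg⟩ := hT.2 (c i)
      have : c i * F i = T (X i ^ D * g) := by
        rw [← hg, mul_comm, mul_substPow hD]; rfl
      rw [LinearMap.mem_ker, this, LinearMap.comp_apply, LinearEquiv.coe_coe,
        LinearEquiv.symm_apply_apply]
      ext a
      simp only [π, LinearMap.pi_apply, lcoeff_apply, Pi.zero_apply]
      rw [X_pow_eq_monomial, coeff_monomial_mul', if_neg]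
      intro h
      have h1 := h i
      simp only [Finsupp.single_eq_same, ι, Finsupp.equivFunOnFinite_symm_apply_apply] at h1
      have := (a i).2
      omega
    · intro p hp
      obtain ⟨g, rfl⟩ := T.surjective p
      rw [LinearMap.mem_ker, LinearMap.comp_apply, LinearEquiv.coe_coe,
        LinearEquiv.symm_apply_apply] at hp
      rw [Submodule.restrictScalars_mem]
      change substPow D F g ∈ _
      rw [substPow_eq_sum]
      refine Ideal.sum_mem _ fun e he => ?_
      obtain ⟨i, hi⟩ : ∃ i, D ≤ e i := by
        by_contra! hlt
        have h0 : coeff (ι fun i => ⟨e i, hlt i⟩) g = 0 := congrFun hp _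
        rw [show (ι fun i => ⟨e i, hlt i⟩) = e from Finsupp.ext fun _ => rfl] at h0
        exact mem_support_iff.1 he h0
      rw [smul_eq_C_mul]
      refine Ideal.mul_mem_left _ _ ?_
      refine Ideal.mem_of_dvd _ ((Dvd.intro_left _ rfl).trans
        (Finset.dvd_prod_of_mem (fun i => X i ^ (e i % D) * F i ^ (e i / D))
          (Finset.mem_univ i))) ?_
      exact Ideal.pow_mem_of_mem _ (Ideal.subset_span (Set.mem_range_self i)) _ (Nat.div_pos hi hD)
  rw [← ((Submodule.Quotient.restrictScalarsEquiv ℝ (Ideal.span (Set.range F))).finrank_eq),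
    (Submodule.quotEquivOfEq _ _ hI).finrank_eq,
    (LinearMap.quotKerEquivOfSurjective (π ∘ₗ T.symm.toLinearMap)
      (hπ.comp T.symm.surjective :)).finrank_eq]
  simp

/-- For all but countably many `u`, the real system `x i ^ D + u * f i x = 0` with `D` odd
and `f i` of degree at most `D` has a solution. -/
theorem exists_countable_forall_exists_zero {σ : Type} [Fintype σ] {D : ℕ} (hD : Odd D)
    {f : σ → MvPolynomial σ ℝ} (hf : ∀ i, (f i).totalDegree ≤ D) :
    ∃ Z : Set ℝ, Z.Countable ∧ ∀ u ∉ Z, ∃ x : σ → ℝ, ∀ i, x i ^ D + u * eval x (f i) = 0 := by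
  obtain ⟨Z, hZ, h⟩ := exists_countable_bijective_substPow hf
  refine ⟨Z, hZ, fun u hu => ?_⟩
  obtain ⟨x, hx⟩ := exists_zero_of_odd_finrank_quotient _
    (finrank_quotient_span_of_bijective_substPow hD.pos (h u hu) ▸ hD.pow)
  exact ⟨x, fun i => by simpa using hx _ (Ideal.subset_span ⟨i, rfl⟩)⟩

end MvPolynomial

/-! ### Odd forms and Borsuk–Ulam -/

namespace MvPolynomial

theorem IsHomogeneous.eval_mul_left {σ R : Type*} [CommRing R] {p : MvPolynomial σ R} {n : ℕ}
    (hp : p.IsHomogeneous n) (c : R) (x : σ → R) :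
    eval (fun i => c * x i) p = c ^ n * eval x p := by
  rw [eval_eq, eval_eq, Finset.mul_sum]
  refine Finset.sum_congr rfl fun e he => ?_
  rw [hp.degree_eq_sum_deg_support he, ← Finset.prod_pow_eq_pow_sum]
  simp only [mul_pow, Finset.prod_mul_distrib]
  ring

theorem totalDegree_aeval_le {σ τ R : Type*} [CommRing R] {g : σ → MvPolynomial τ R}
    (hg : ∀ i, (g i).totalDegree ≤ 1) (p : MvPolynomial σ R) :
    (aeval g p).totalDegree ≤ p.totalDegree := by
  rw [aeval_def, eval₂_eq]
  refine (totalDegree_finsetSum _ _).trans (Finset.sup_le fun e he => ?_)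
  rw [algebraMap_eq, ← smul_eq_C_mul]
  refine (totalDegree_smul_le _ _).trans ((totalDegree_finsetProd _ _).trans
    (le_trans (Finset.sum_le_sum fun i _ => ?_) (le_totalDegree he)))
  exact (totalDegree_pow _ _).trans ((Nat.mul_le_mul_left _ (hg i)).trans (mul_one _).le)

end MvPolynomial

theorem isCompact_setOf_sum_sq_eq_one (m : ℕ) : IsCompact {x : Fin m → ℝ | ∑ i, x i ^ 2 = 1} := by
  refine Metric.isCompact_of_isClosed_isBounded
    (isClosed_eq (by fun_prop) continuous_const) ?_
  refine (Metric.isBounded_closedBall (x := (0 : Fin m → ℝ)) (r := 1)).subset fun x hx => ?_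
  rw [mem_closedBall_zero_iff, pi_norm_le_iff_of_nonneg zero_le_one]
  intro i
  rw [Real.norm_eq_abs, ← sq_le_one_iff_abs_le_one]
  exact (Finset.single_le_sum (fun j _ => sq_nonneg (x j)) (Finset.mem_univ i)).trans_eq hx

/-- The norm of `g` attains its minimum, so approximate zeros suffice. -/
theorem IsCompact.exists_eq_zero_of_forall_exists_abs_le {X ι : Type*} [TopologicalSpace X]
    [Fintype ι] {S : Set X} (hS : IsCompact S) {g : X → ι → ℝ} (hg : ContinuousOn g S)
    (h : ∀ δ > 0, ∃ x ∈ S, ∀ i, |g x i| ≤ δ) : ∃ x ∈ S, ∀ i, g x i = 0 := by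
  have hne : S.Nonempty := (h 1 one_pos).imp fun x hx => hx.1
  obtain ⟨x, hx, hmin⟩ := hS.exists_isMinOn hne hg.norm
  refine ⟨x, hx, fun i => ?_⟩
  have : ‖g x‖ ≤ 0 := by
    by_contra! hpos
    obtain ⟨y, hy, hle⟩ := h (‖g x‖ / 2) (half_pos hpos)
    have h1 : ‖g y‖ ≤ ‖g x‖ / 2 := (pi_norm_le_iff_of_nonneg (half_pos hpos).le).2 hle
    have h2 : ‖g x‖ ≤ ‖g y‖ := hmin hy
    linarith
  rw [norm_le_zero_iff.1 this, Pi.zero_apply]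

open MvPolynomial in
/-- Real forms of odd degree in more variables than forms have a nontrivial common zero. -/
theorem exists_common_zero_of_isHomogeneous_of_odd {n D : ℕ} (hD : Odd D)
    {f : Fin n → MvPolynomial (Fin (n + 1)) ℝ} (hf : ∀ i, (f i).IsHomogeneous D) :
    ∃ x : Fin (n + 1) → ℝ, ∑ i, x i ^ 2 = 1 ∧ ∀ i, eval x (f i) = 0 := by
  refine (isCompact_setOf_sum_sq_eq_one (n + 1)).exists_eq_zero_of_forall_exists_abs_le
    (g := fun x i => eval x (f i))
    (continuous_pi fun i => continuous_eval (f i)).continuousOn fun δ hδ => ?_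
  let s : Fin (n + 1) → MvPolynomial (Fin n) ℝ := Fin.cons 1 X
  have hs : ∀ i, (s i).totalDegree ≤ 1 := fun i => by
    cases i using Fin.cases <;> simp [s]
  obtain ⟨Z, hZ, h⟩ := exists_countable_forall_exists_zero hD (f := fun i => aeval s (f i))
    fun i => (totalDegree_aeval_le hs _).trans (hf i).totalDegree_le
  -- On the normalised zero the forms have size at most `u⁻¹`, hence the choice `u > δ⁻¹`.
  obtain ⟨u, huZ, hu⟩ := (hZ.dense_compl ℝ).exists_mem_open isOpen_Ioi
    (Set.nonempty_Ioi (a := δ⁻¹))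
  have hu : δ⁻¹ < u := hu
  have hu0 : 0 < u := (inv_pos.2 hδ).trans hu
  obtain ⟨x, hx⟩ := h u huZ
  let z : Fin (n + 1) → ℝ := Fin.cons 1 x
  have hz : ∀ p : MvPolynomial (Fin (n + 1)) ℝ, eval x (aeval s p) = eval z p := fun p => by
    rw [← MvPolynomial.coe_aeval_eq_eval, ← MvPolynomial.coe_aeval_eq_eval]
    change ((aeval x).comp (aeval s)) p = _
    have : (fun i => aeval x (s i)) = z := by
      funext i
      cases i using Fin.cases <;> simp [s, z]
    rw [comp_aeval, this]
    rfl
  have hpos : 0 < ∑ i, z i ^ 2 := by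
    rw [Fin.sum_univ_succ]
    simp only [z, Fin.cons_zero]
    positivity
  set r := √(∑ i, z i ^ 2) with hr
  have hr0 : 0 < r := Real.sqrt_pos.2 hpos
  have hsq : ∑ i, (r⁻¹ * z i) ^ 2 = 1 := by
    simp_rw [mul_pow]
    rw [← Finset.mul_sum, inv_pow, hr, Real.sq_sqrt hpos.le, inv_mul_cancel₀ hpos.ne']
  refine ⟨fun i => r⁻¹ * z i, hsq, fun i => ?_⟩
  have hi := hx i
  simp only [hz] at hi
  have hle : |r⁻¹ * z i.succ| ≤ 1 := by
    rw [← sq_le_one_iff_abs_le_one, ← hsq]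
    exact Finset.single_le_sum (f := fun j => (r⁻¹ * z j) ^ 2) (fun j _ => sq_nonneg _)
      (Finset.mem_univ i.succ)
  have heq : eval (fun i => r⁻¹ * z i) (f i) = -(u⁻¹ * (r⁻¹ * z i.succ) ^ D) := by
    rw [(hf i).eval_mul_left, mul_pow]
    have : z i.succ = x i := Fin.cons_succ ..
    rw [this, eq_neg_of_add_eq_zero_left hi]
    field_simp
  rw [heq, abs_neg, abs_mul, abs_pow, abs_of_pos (inv_pos.2 hu0)]
  calc u⁻¹ * |r⁻¹ * z i.succ| ^ D ≤ u⁻¹ * 1 := by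
        gcongr
        exact pow_le_one₀ (abs_nonneg _) hle
    _ ≤ δ := by rw [mul_one]; exact inv_le_of_inv_le₀ hδ hu.le

open MvPolynomial in
theorem exists_mvPolynomial_near_of_isCompact {σ : Type*} {S : Set (σ → ℝ)}
    (hS : IsCompact S) {f : (σ → ℝ) → ℝ} (hf : ContinuousOn f S) {δ : ℝ} (hδ : 0 < δ) :
    ∃ p : MvPolynomial σ ℝ, ∀ x ∈ S, |eval x p - f x| < δ := by
  have := isCompact_iff_compactSpace.1 hS
  let c : σ → C(S, ℝ) := fun i => ⟨fun x => x.1 i,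
    (continuous_apply i).comp continuous_subtype_val⟩
  have hc : ∀ (p : MvPolynomial σ ℝ) (x : S), aeval c p x = eval x.1 p := fun p x => by
    change (ContinuousMap.evalAlgHom ℝ ℝ x).comp (aeval c) p = _
    rw [comp_aeval, ← MvPolynomial.coe_aeval_eq_eval]
    rfl
  have hsep : (aeval (R := ℝ) c).range.SeparatesPoints := fun x y hxy => by
    obtain ⟨i, hi⟩ := Function.ne_iff.1 (Subtype.coe_ne_coe.2 hxy)
    exact ⟨c i, ⟨c i, ⟨X i, aeval_X c i⟩, rfl⟩, hi⟩
  obtain ⟨⟨g, p, rfl⟩, hg⟩ :=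
    ContinuousMap.exists_mem_subalgebra_near_continuous_of_separatesPoints _ hsep
      (S.domRestrict f) (continuousOn_iff_continuous_domRestrict.1 hf) δ hδ
  refine ⟨p, fun x hx => ?_⟩
  have := hg ⟨x, hx⟩
  rw [← hc p ⟨x, hx⟩]
  exact this

open MvPolynomial in
/-- On the unit sphere the odd part of a polynomial agrees with a form of odd degree. -/
theorem exists_isHomogeneous_eval_eq_odd_part {m k : ℕ} {p : MvPolynomial (Fin m) ℝ}
    (hp : p.totalDegree ≤ 2 * k) :
    ∃ q : MvPolynomial (Fin m) ℝ, q.IsHomogeneous (2 * k + 1) ∧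
      ∀ x : Fin m → ℝ, ∑ i, x i ^ 2 = 1 → eval x q = (eval x p - eval (-x) p) / 2 := by
  -- Powers of `∑ X i ^ 2`, which is 1 on the sphere, lift all odd components to the same degree.
  refine ⟨∑ j ∈ Finset.range (k + 1),
    homogeneousComponent (2 * j + 1) p * (∑ i, X i ^ 2) ^ (k - j), ?_, fun x hx => ?_⟩
  · refine IsHomogeneous.sum _ _ _ fun j hj => ?_
    have hj := Finset.mem_range.1 hj
    rw [show 2 * k + 1 = 2 * j + 1 + 2 * (k - j) by omega]
    exact (homogeneousComponent_isHomogeneous _ _).mul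
      ((IsHomogeneous.sum _ _ _ fun i _ => isHomogeneous_X_pow i 2).pow _)
  · have hcomp : p = ∑ j ∈ Finset.range (2 * (k + 1)), homogeneousComponent j p := by
      conv_lhs => rw [← sum_homogeneousComponent p]
      refine Finset.sum_subset (Finset.range_subset_range.2 (by omega)) fun j _ hj => ?_
      exact homogeneousComponent_eq_zero _ _ (by simpa using hj)
    have hodd : ∀ j, eval (-x) (homogeneousComponent j p) =
        (-1) ^ j * eval x (homogeneousComponent j p) := fun j => by
      rw [← (homogeneousComponent_isHomogeneous j p).eval_mul_left]
      congr 2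
      ext i
      simp
    have hsum : ∀ (K : ℕ) (a : ℕ → ℝ), (∑ j ∈ Finset.range (2 * K), a j -
        ∑ j ∈ Finset.range (2 * K), (-1) ^ j * a j) / 2 =
          ∑ j ∈ Finset.range K, a (2 * j + 1) := fun K a => by
      induction K with
      | zero => simp
      | succ K ih =>
        rw [Finset.sum_range_succ _ K, ← ih, mul_add, mul_one, Finset.sum_range_succ,
          Finset.sum_range_succ, Finset.sum_range_succ, Finset.sum_range_succ, pow_succ,
          pow_mul]
        norm_num
        ring
    have h1 := congrArg (eval x) hcomp
    have h2 := congrArg (eval (-x)) hcomp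
    simp only [map_sum, hodd] at h1 h2
    rw [h1, h2, hsum, map_sum]
    refine Finset.sum_congr rfl fun j _ => ?_
    simp [hx]

open MvPolynomial in
/-- The **Borsuk–Ulam theorem**: an odd continuous map from the `n`-sphere to `ℝⁿ` has a zero. -/
theorem borsuk_ulam {n : ℕ} {f : (Fin (n + 1) → ℝ) → Fin n → ℝ}
    (hf : ContinuousOn f {x | ∑ i, x i ^ 2 = 1})
    (hodd : ∀ x, ∑ i, x i ^ 2 = 1 → f (-x) = -f x) :
    ∃ x, ∑ i, x i ^ 2 = 1 ∧ ∀ i, f x i = 0 := by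
  refine (isCompact_setOf_sum_sq_eq_one (n + 1)).exists_eq_zero_of_forall_exists_abs_le hf
    fun δ hδ => ?_
  choose p hp using fun i => exists_mvPolynomial_near_of_isCompact
    (isCompact_setOf_sum_sq_eq_one (n + 1)) (f := fun x => f x i)
    ((continuous_apply i).comp_continuousOn hf) hδ
  let k := Finset.univ.sup fun i => (p i).totalDegree
  choose q hq hq' using fun i => exists_isHomogeneous_eval_eq_odd_part (p := p i) (k := k)
    ((Finset.le_sup (f := fun i => (p i).totalDegree) (Finset.mem_univ i)).trans (by omega))
  obtain ⟨x, hx, hx0⟩ := exists_common_zero_of_isHomogeneous_of_odd (odd_two_mul_add_one k) hq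
  refine ⟨x, hx, fun i => ?_⟩
  have h0 := hx0 i
  rw [hq' i x hx] at h0
  have h1 := hp i x hx
  have h2 := hp i (-x) (by simpa using hx)
  rw [hodd x hx] at h2
  simp only [Pi.neg_apply] at h2
  rw [abs_lt] at h1 h2
  rw [abs_le]
  constructor <;> linarith

/-! ### Halfspaces parametrised by the sphere -/

theorem volume_setOf_inner_eq {d : ℕ} {v : EuclideanSpace ℝ (Fin d)} (hv : v ≠ 0) (c : ℝ) :
    volume {y | inner ℝ v y = c} = 0 := by
  rcases Set.eq_empty_or_nonempty {y | inner ℝ v y = c} with h | ⟨y₀, hy₀⟩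
  · rw [h, measure_empty]
  have hset : {y | inner ℝ v y = c} =
      (AffineSubspace.mk' y₀ (LinearMap.ker (innerSL ℝ v).toLinearMap) : Set _) := by
    ext y
    have hy₀ : inner ℝ v y₀ = c := hy₀
    simp [AffineSubspace.mem_mk', inner_sub_right, hy₀, sub_eq_zero]
  rw [hset]
  refine Measure.addHaar_affineSubspace _ _ fun htop => hv ?_
  have hdir := congrArg AffineSubspace.direction htop
  rw [AffineSubspace.direction_mk', AffineSubspace.direction_top] at hdir
  have hmem : v ∈ LinearMap.ker (innerSL ℝ v).toLinearMap := hdir ▸ Submodule.mem_top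
  simpa using hmem

/-- The normal vector of the halfspace with parameter `x`. -/
def halfspaceNormal {d : ℕ} (x : Fin (d + 1) → ℝ) : EuclideanSpace ℝ (Fin d) :=
  WithLp.toLp 2 fun i => x i.succ

/-- The possibly degenerate halfspace with parameter `x`. -/
def halfspaceOf {d : ℕ} (x : Fin (d + 1) → ℝ) : Set (EuclideanSpace ℝ (Fin d)) :=
  {y | inner ℝ (halfspaceNormal x) y ≤ x 0}

section

variable {d : ℕ}

theorem isHalfspace_halfspaceOf {x : Fin (d + 1) → ℝ} (hx : halfspaceNormal x ≠ 0) :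
    IsHalfspace (halfspaceOf x) :=
  ⟨halfspaceNormal x, x 0, hx, rfl⟩

theorem halfspaceNormal_neg (x : Fin (d + 1) → ℝ) :
    halfspaceNormal (-x) = -halfspaceNormal x := rfl

theorem continuous_halfspaceNormal : Continuous (halfspaceNormal (d := d)) := by
  unfold halfspaceNormal
  fun_prop

theorem measurableSet_halfspaceOf (x : Fin (d + 1) → ℝ) : MeasurableSet (halfspaceOf x) :=
  measurableSet_le (by fun_prop) measurable_const

theorem ne_zero_of_halfspaceNormal_eq_zero {x : Fin (d + 1) → ℝ} (hx : ∑ i, x i ^ 2 = 1)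
    (h : halfspaceNormal x = 0) : x 0 ≠ 0 := by
  have hs : ∀ i : Fin d, x i.succ = 0 := fun i => congrArg (fun v => v.ofLp i) h
  intro h0
  simp [Fin.sum_univ_succ, hs, h0] at hx

variable {μ : Measure (EuclideanSpace ℝ (Fin d))}

theorem measure_boundary_eq_zero (hac : μ.AbsolutelyContinuous volume) {x : Fin (d + 1) → ℝ}
    (hx : ∑ i, x i ^ 2 = 1) : μ {y | inner ℝ (halfspaceNormal x) y = x 0} = 0 := by
  by_cases h : halfspaceNormal x = 0
  · simp [h, (ne_zero_of_halfspaceNormal_eq_zero hx h).symm]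
  · exact hac (volume_setOf_inner_eq h _)

theorem real_halfspaceOf_neg [IsProbabilityMeasure μ] (hac : μ.AbsolutelyContinuous volume)
    {x : Fin (d + 1) → ℝ} (hx : ∑ i, x i ^ 2 = 1) :
    μ.real (halfspaceOf (-x)) = 1 - μ.real (halfspaceOf x) := by
  rw [← probReal_compl_eq_one_sub (measurableSet_halfspaceOf x)]
  refine measureReal_congr ?_
  have hb : ∀ᵐ y ∂μ, ¬ inner ℝ (halfspaceNormal x) y = x 0 :=
    measure_eq_zero_iff_ae_notMem.1 (measure_boundary_eq_zero hac hx)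
  filter_upwards [hb] with y hy
  refine propext ?_
  change inner ℝ (halfspaceNormal (-x)) y ≤ -x 0 ↔ ¬ inner ℝ (halfspaceNormal x) y ≤ x 0
  rw [halfspaceNormal_neg, inner_neg_left, neg_le_neg_iff, not_le]
  exact ⟨fun h => lt_of_le_of_ne h (Ne.symm hy), le_of_lt⟩

/-- Off the null boundary, membership of a point in the halfspace is locally constant in the
parameter, so the indicators converge almost everywhere. -/
theorem continuousOn_real_halfspaceOf [IsProbabilityMeasure μ]
    (hac : μ.AbsolutelyContinuous volume) :
    ContinuousOn (fun x => μ.real (halfspaceOf x)) {x | ∑ i, x i ^ 2 = 1} := by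
  intro x hx
  refine ContinuousAt.continuousWithinAt ?_
  refine (ENNReal.tendsto_toReal (measure_ne_top μ _)).comp ?_
  refine tendsto_measure_of_ae_tendsto_indicator_of_isFiniteMeasure _
    (measurableSet_halfspaceOf x) measurableSet_halfspaceOf ?_
  have hb : ∀ᵐ y ∂μ, ¬ inner ℝ (halfspaceNormal x) y = x 0 :=
    measure_eq_zero_iff_ae_notMem.1 (measure_boundary_eq_zero hac hx)
  filter_upwards [hb] with y hy
  have hcont : Continuous fun z : Fin (d + 1) → ℝ => inner ℝ (halfspaceNormal z) y :=
    continuous_halfspaceNormal.inner continuous_const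
  rcases lt_or_gt_of_ne hy with h | h
  · filter_upwards [hcont.continuousAt.eventually_lt (continuous_apply 0).continuousAt h] with z hz
    exact ⟨fun _ => h.le, fun _ => hz.le⟩
  · filter_upwards [(continuous_apply 0).continuousAt.eventually_lt hcont.continuousAt h] with z hz
    exact ⟨fun h' => absurd h' hz.not_ge, fun h' => absurd h' h.not_ge⟩

end

/-! ### The test map and the main theorem -/

/-- A continuous function of the values `a i`, positive exactly when they are all below `ε`. -/
def belowWeight {ι : Type*} [Fintype ι] (ε : ℝ) (a : ι → ℝ) : ℝ := ∏ i, max 0 (ε - a i)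

theorem belowWeight_nonneg {ι : Type*} [Fintype ι] (ε : ℝ) (a : ι → ℝ) : 0 ≤ belowWeight ε a :=
  Finset.prod_nonneg fun _ _ => le_max_left _ _

theorem belowWeight_pos_iff {ι : Type*} [Fintype ι] {ε : ℝ} {a : ι → ℝ} :
    0 < belowWeight ε a ↔ ∀ i, a i < ε := by
  refine ⟨fun h i => ?_, fun h => Finset.prod_pos fun i _ => lt_max_of_lt_right (sub_pos.2 (h i))⟩
  by_contra! hi
  exact h.ne' (Finset.prod_eq_zero (Finset.mem_univ i) (max_eq_left (sub_nonpos.2 hi)))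

theorem theorem1 (d : ℕ) (hd : 1 ≤ d) (ε : ℝ) (hε : ε ∈ Set.Ioo (0 : ℝ) (1 / 2))
    (μ : Fin (d + 1) → Measure (EuclideanSpace ℝ (Fin d)))
    (hprob : ∀ i, IsProbabilityMeasure (μ i))
    (hac : ∀ i, (μ i).AbsolutelyContinuous volume)
    (hnp : NotPermuted ε μ) :
    ∃ H : Set (EuclideanSpace ℝ (Fin d)), IsHalfspace H ∧
      ∃ c ∈ Set.Icc ε (1 / 2), ∀ i, (μ i).real H = c := by
  obtain ⟨hε0, hε2⟩ := hε
  let m (x : Fin (d + 1) → ℝ) (i : Fin (d + 1)) : ℝ := (μ i).real (halfspaceOf x)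
  let φ (x : Fin (d + 1) → ℝ) : ℝ :=
    belowWeight ε (m x) - belowWeight ε fun i => 1 - m x i
  have hm : ∀ i, ContinuousOn (fun x => m x i) {x | ∑ i, x i ^ 2 = 1} := fun i =>
    continuousOn_real_halfspaceOf (hac i)
  have hφ : ContinuousOn φ {x | ∑ i, x i ^ 2 = 1} := by
    unfold φ belowWeight
    fun_prop
  have hneg : ∀ x, ∑ i, x i ^ 2 = 1 → ∀ i, m (-x) i = 1 - m x i := fun x hx i =>
    real_halfspaceOf_neg (hac i) hx
  have hφneg : ∀ x, ∑ i, x i ^ 2 = 1 → φ (-x) = -φ x := fun x hx => by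
    simp only [φ, hneg x hx, sub_sub_cancel, neg_sub]
    congr 2
    exact funext (hneg x hx)
  -- The weight `φ` rules out zeros at halfspaces that are too small or too large.
  obtain ⟨x, hx, hx0⟩ := borsuk_ulam (f := fun x i => m x i.succ - m x i.castSucc - φ x)
    (continuousOn_pi.2 fun i => ((hm _).sub (hm _)).sub hφ) fun x hx => by
      ext i
      simp only [hneg x hx, hφneg x hx, Pi.neg_apply]
      ring
  have not_pos : ∀ x, ∑ i, x i ^ 2 = 1 →
      (∀ i : Fin d, m x i.succ - m x i.castSucc - φ x = 0) → halfspaceNormal x ≠ 0 →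
      φ x ≤ 0 := fun x _ hx0 hv => by
    by_contra! hpos
    have hlt : ∀ i, m x i < ε := belowWeight_pos_iff.1
      (hpos.trans_le (sub_le_self _ (belowWeight_nonneg _ _)))
    obtain ⟨i, j, hij, hle⟩ := hnp _ (isHalfspace_halfspaceOf hv) hlt
    have hmono : StrictMono (m x) := Fin.strictMono_iff_lt_succ.2 fun i => by
      linarith [hx0 i]
    exact hle.not_gt (hmono hij)
  have hxn : ∑ i, (-x) i ^ 2 = 1 := by simpa using hx
  have hφx : φ x = 0 := by
    by_cases hv : halfspaceNormal x = 0
    -- A degenerate halfspace is empty or everything, so all masses agree; one coordinate of the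
    -- test map, available as `d ≥ 1`, then gives `φ x = 0`.
    · have hconst : ∀ i j, m x i = m x j := fun i j => by
        by_cases h : 0 ≤ x 0 <;> simp [m, halfspaceOf, hv, h]
      have h := hx0 ⟨0, hd⟩
      rw [hconst _ (Fin.castSucc ⟨0, hd⟩)] at h
      linarith
    · refine le_antisymm (not_pos x hx hx0 hv) ?_
      have h := not_pos (-x) hxn (fun i => by
        rw [hneg x hx, hneg x hx, hφneg x hx]
        linarith [hx0 i]) (by rwa [halfspaceNormal_neg, neg_ne_zero])
      rw [hφneg x hx] at h
      linarith
  obtain ⟨c, hc⟩ : ∃ c, ∀ i, m x i = c := by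
    refine ⟨m x 0, fun i => ?_⟩
    induction i using Fin.induction with
    | zero => rfl
    | succ i ih => linarith [hx0 i]
  have hweights : belowWeight ε (m x) = belowWeight ε fun i => 1 - m x i := sub_eq_zero.1 hφx
  -- Equal weights are both positive or both zero; both positive would force `c < ε` and `1 - c <
  -- ε`, impossible for `ε < 1 / 2`.
  have hcε : ε ≤ c := by
    by_contra! h
    have h1 : 0 < belowWeight ε (m x) := belowWeight_pos_iff.2 fun i => (hc i).trans_lt h
    rw [hweights] at h1
    linarith [belowWeight_pos_iff.1 h1 0, hc 0]
  have hcε' : c ≤ 1 - ε := by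
    by_contra! h
    have h1 : 0 < belowWeight ε fun i => 1 - m x i :=
      belowWeight_pos_iff.2 fun i => by linarith [hc i]
    rw [← hweights] at h1
    linarith [belowWeight_pos_iff.1 h1 0, hc 0]
  have hv : halfspaceNormal x ≠ 0 := fun hv => by
    have h0 := hc 0
    by_cases h : 0 ≤ x 0
    · have : m x 0 = 1 := by simp [m, halfspaceOf, hv, h]
      linarith
    · have : m x 0 = 0 := by simp [m, halfspaceOf, hv, h]
      linarith
  rcases le_total c (1 / 2) with h | h
  · exact ⟨_, isHalfspace_halfspaceOf hv, c, ⟨hcε, h⟩, hc⟩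
  · refine ⟨halfspaceOf (-x), isHalfspace_halfspaceOf
      (by rwa [halfspaceNormal_neg, neg_ne_zero]), 1 - c, ⟨by linarith, by linarith⟩, fun i => ?_⟩
    rw [← hc i]
    exact hneg x hx i
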